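/- Let $F$ be a real quadratic field of narrow class number one, with real embeddings $v_1,v_2$, ring of integers $\mathcal O_F$, discriminant $d_F$, regulator $R_F$, and let $\delta$ be a totally positive generator of the different of $F/\mathbf Q$. Let $\Gamma=\mathrm{SL}_2(\mathcal O_F)$ act on $\mathcal H\times\mathcal H$ through $(v_1,v_2)$ by homographies, and put $\mathcal X=\Gamma\backslash(\mathcal H\times\mathcal H)$. Write $z_j=x_j+iy_j$ for the coordinates, and let $$E_2(z_1,z_2)=\zeta_F(-1)+4\sum_{\mu\in\mathcal O_F,\ \mu\gg0}\sigma_1(\mu)\,e^{2i\pi\left(\frac{v_1(\mu)}{v_1(\delta)}z_1+\frac{v_2(\mu)}{v_2(\delta)}z_2\right)},\qquad \sigma_1(\mu)=\sum_{\mathfrak a\mid(\mu)}\mathrm N\mathfrak a ,$$ $$\omega_{\mathrm{Eis}}=\frac{(2i\pi)^2}{\sqrt{d_F}}E_2\,dz_1\wedge dz_2+\frac{R_F}{2}\left(\frac{dz_1\wedge d\bar z_1}{y_1^2}-\frac{dz_2\wedge d\bar z_2}{y_2^2}\right),$$ a $\Gamma$-invariant closed $2$-form. Chains on $\mathcal X$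 are integral combinations of differentiable singular simplices, i.e. of images of $C^\infty$ simplices of $\mathcal H\times\mathcal H$. Let $\Lambda_{\mathrm{Eis}}\subset\mathbf C$ be the group of integrals of $\omega_{\mathrm{Eis}}$ over closed $2$-chains of $\mathcal X$, let $n_F$ be the exponent of the torsion subgroup of $H_1(\mathcal X,\mathbf Z)$, and put $\Lambda'_{\mathrm{Eis}}=\frac1{n_F}\Lambda_{\mathrm{Eis}}$. For a $1$-chain $\Delta$ on $\mathcal X$ that is the boundary of a $2$-chain with rational coefficients, put $$\Phi_{\mathrm{Eis}}(\Delta)=\frac1{n_F}\int_{C}\omega_{\mathrm{Eis}}\in\mathbf C/\Lambda'_{\mathrm{Eis}},\qquad \partial C=n_F\Delta ,$$ where $C$ is any integral $2$-chain with this boundary. (All closed $1$-chains on $\mathcal X$ are boundaries of rational $2$-chains, because $H_1(\mathcal X,\mathbf Q)=0$.) For $P\in\mathcal H\times\mathcal H$ and $A\in\Gamma$ let $S_P(A)$ be the image in $\mathcal X$ of the geodesic path from $P$ to $AP$, and put $$\rho_P(A)=\frac1{n_F}\int_{D}\omega_{\mathrm{Eis}}\in\mathbf C/\Lambda'_{\mathrm{Eis}},\qquad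 \partial D=n_F\,S_P(A).$$ Let $K/F$ be a quadratic extension such that $v_1$ extends to a complex place of $K$ and $v_2$ to two real places (so $K$ is ATR). Let $\tau\in K$ be such that $(1,\tau)$ is a positive basis of $K$ over $F$: the image $\tau_1$ of $\tau$ under the chosen complex embedding above $v_1$ lies in $\mathcal H$, and its images $\tau_2,\tau_2'$ under the two real embeddings above $v_2$ satisfy $\tau_2<\tau_2'$. Let $\Upsilon_2\subset\mathcal H$ be the geodesic joining $\tau_2$ to $\tau_2'$, oriented from $\tau_2$ to $\tau_2'$, let $\Gamma_\tau$ be the stabilizer of $\tau$ in $\Gamma$, and let $\Delta_\tau$ be the image in $\mathcal X$ of an arc of $\{\tau_1\}\times\Upsilon_2$, with the orientation of $\Upsilon_2$, that is a fundamental domain for the action of $\Gamma_\tau$. Let $\gamma_\tau$ be a generator of $\Gamma_\tau$ modulo torsion such that, for every $z\in\Upsilon_2$, the path on $\Upsilon_2$ from $z$ to $\gamma_\tau z$ is positively oriented. Finally let $P=(\tau_1,z_2)$ with $z_2\in\Upsilon_2$. Then $$\Phi_{\mathrm{Eis}}(\Delta_\tau)=\rho_P(\gamma_\tau)\quad\text{in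 }\mathbf C/\Lambda'_{\mathrm{Eis}} .$$ -/

import Mathlib

open scoped NumberField MatrixGroups ContDiff

noncomputable section

namespace HilbertEis

open UpperHalfPlane

/-! ### Arithmetic of the real quadratic field -/

section Arithmetic

variable {F : Type*} [Field F]

/-- Total positivity with respect to the two real embeddings `v 0`, `v 1`. -/
def TotPos (v : Fin 2 → F →+* ℝ) (x : F) : Prop := ∀ j, 0 < v j x

/-- Narrow class number one: every nonzero ideal has a totally positive generator. -/
def NarrowClassNumberOne (v : Fin 2 → F →+* ℝ) : Prop :=
  ∀ I : Ideal (𝓞 F), I ≠ ⊥ → ∃ a : 𝓞 F, TotPos v (a : F) ∧ I = Ideal.span {a}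

variable [NumberField F]

/-- `δ` is a totally positive generator of the different of `F / ℚ`. -/
def IsPosDifferentGenerator (v : Fin 2 → F →+* ℝ) (δ : 𝓞 F) : Prop :=
  TotPos v (δ : F) ∧ Ideal.span {δ} = differentIdeal ℤ (𝓞 F)

/-- `σ₁(μ)`: the sum of the norms of the integral ideals dividing `(μ)`. -/
def sigmaOne (μ : 𝓞 F) : ℕ :=
  ∑ᶠ (I : Ideal (𝓞 F)) (_ : I ∣ Ideal.span {μ}), Ideal.absNorm I

variable (F) in
/-- `ζ_F(s)` for `s ≠ 1`: the (unique) holomorphic continuation to `ℂ ∖ {1}` of the Dedekind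
zeta function, which Mathlib defines by its Dirichlet series on `Re s > 1`. -/
def zetaF : ℂ → ℂ :=
  Classical.epsilon fun g : ℂ → ℂ =>
    DifferentiableOn ℂ g {1}ᶜ ∧ ∀ s : ℂ, 1 < s.re → g s = NumberField.dedekindZeta F s

/-- The holomorphic Eisenstein series of weight `(2, 2)`, through its Fourier expansion. -/
def E2 (v : Fin 2 → F →+* ℝ) (δ : 𝓞 F) (z : ℍ × ℍ) : ℂ :=
  zetaF F (-1) + 2 ^ 2 * ∑' μ : {μ : 𝓞 F // TotPos v (μ : F)},
    (sigmaOne μ.1 : ℂ) * Complex.exp (2 * Complex.I * Real.pi *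
      (((v 0 (μ.1 : F) / v 0 (δ : F) : ℝ) : ℂ) * (z.1 : ℂ) +
        ((v 1 (μ.1 : F) / v 1 (δ : F) : ℝ) : ℂ) * (z.2 : ℂ)))

/-- The value at `z` on tangent vectors `u, w ∈ ℂ × ℂ` of the differential 2-form
`ω_Eis = (2iπ)² / √d_F · E₂ dz₁ ∧ dz₂ + R_F / 2 · (dz₁ ∧ dz̄₁ / y₁² - dz₂ ∧ dz̄₂ / y₂²)`. -/
def omegaEis (v : Fin 2 → F →+* ℝ) (δ : 𝓞 F) (z : ℍ × ℍ) (u w : ℂ × ℂ) : ℂ :=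
  (2 * Complex.I * Real.pi) ^ 2 / (Real.sqrt (NumberField.discr F : ℝ) : ℂ) * E2 v δ z *
      (u.1 * w.2 - w.1 * u.2) +
    (NumberField.Units.regulator F : ℂ) / 2 *
      ((u.1 * (starRingEnd ℂ) w.1 - w.1 * (starRingEnd ℂ) u.1) / (z.1.im : ℂ) ^ 2 -
        (u.2 * (starRingEnd ℂ) w.2 - w.2 * (starRingEnd ℂ) u.2) / (z.2.im : ℂ) ^ 2)

end Arithmetic

/-! ### The Hilbert modular group and its quotient -/

section Quotient

variable {F : Type*} [Field F]

/-- `A ↦ A_j`, the embedding `SL₂(𝓞_F) → SL₂(ℝ)` attached to a real embedding of `F`. -/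
def embSL (φ : F →+* ℝ) : SL(2, 𝓞 F) →* SL(2, ℝ) :=
  Matrix.SpecialLinearGroup.map (φ.comp (algebraMap (𝓞 F) F))

/-- The action of `Γ = SL₂(𝓞_F)` on `ℍ × ℍ` by homographies. -/
def act (v : Fin 2 → F →+* ℝ) (A : SL(2, 𝓞 F)) (z : ℍ × ℍ) : ℍ × ℍ :=
  (embSL (v 0) A • z.1, embSL (v 1) A • z.2)

theorem act_one (v : Fin 2 → F →+* ℝ) (z : ℍ × ℍ) : act v 1 z = z := by
  simp [act]

theorem act_mul (v : Fin 2 → F →+* ℝ) (A B : SL(2, 𝓞 F)) (z : ℍ × ℍ) :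
    act v (A * B) z = act v A (act v B z) := by
  simp [act, mul_smul]

/-- Two points of `ℍ × ℍ` are equivalent when they lie in the same `Γ`-orbit. -/
def orbitSetoid (v : Fin 2 → F →+* ℝ) : Setoid (ℍ × ℍ) where
  r z w := ∃ A : SL(2, 𝓞 F), act v A z = w
  iseqv :=
    { refl := fun z => ⟨1, act_one v z⟩
      symm := by
        rintro z w ⟨A, rfl⟩
        exact ⟨A⁻¹, by rw [← act_mul, inv_mul_cancel, act_one]⟩
      trans := by
        rintro z w u ⟨A, rfl⟩ ⟨B, rfl⟩
        exact ⟨B * A, act_mul v B A z⟩ }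

/-- The Hilbert modular surface `𝒳 = Γ \ (ℍ × ℍ)`. -/
def X (v : Fin 2 → F →+* ℝ) : Type := Quotient (orbitSetoid v)

/-- The projection `ℍ × ℍ → 𝒳`. -/
def toX (v : Fin 2 → F →+* ℝ) (z : ℍ × ℍ) : X v := Quotient.mk (orbitSetoid v) z

end Quotient

/-! ### Differentiable singular chains -/

section Chains

/-- A map from the closed standard `m`-simplex to `ℍ × ℍ` is differentiable if it extends to a
`C^∞` map on the ambient space. -/
def IsSmoothSimplex {m : ℕ} (σ : stdSimplex ℝ (Fin (m + 1)) → ℍ × ℍ) : Prop :=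
  ∃ f : (Fin (m + 1) → ℝ) → ℂ × ℂ, ContDiff ℝ ∞ f ∧
    ∀ x : stdSimplex ℝ (Fin (m + 1)), f x = (((σ x).1 : ℂ), ((σ x).2 : ℂ))

/-- Differentiable singular `m`-simplices of `ℍ × ℍ`. -/
def UpSimplex (m : ℕ) : Type :=
  {σ : stdSimplex ℝ (Fin (m + 1)) → ℍ × ℍ // IsSmoothSimplex σ}

/-- The `i`-th face inclusion of standard simplices. -/
def faceMap {m : ℕ} (i : Fin (m + 2)) :
    stdSimplex ℝ (Fin (m + 1)) → stdSimplex ℝ (Fin (m + 2)) :=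
  stdSimplex.map (Fin.succAbove i)

theorem IsSmoothSimplex.face {m : ℕ} {σ : stdSimplex ℝ (Fin (m + 2)) → ℍ × ℍ}
    (h : IsSmoothSimplex σ) (i : Fin (m + 2)) : IsSmoothSimplex (σ ∘ faceMap i) := by
  obtain ⟨f, hf, hfx⟩ := h
  refine ⟨f ∘ (FunOnFinite.linearMap ℝ ℝ (Fin.succAbove i)), ?_, fun x => ?_⟩
  · exact hf.comp (LinearMap.toContinuousLinearMap
      (FunOnFinite.linearMap ℝ ℝ (Fin.succAbove i))).contDiff
  · exact hfx (faceMap i x)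

variable {F : Type*} [Field F] (v : Fin 2 → F →+* ℝ)

/-- Differentiable singular `m`-simplices of `𝒳`: the images of those of `ℍ × ℍ`. -/
def Simplex (m : ℕ) : Type :=
  {s : stdSimplex ℝ (Fin (m + 1)) → X v //
    ∃ σ : stdSimplex ℝ (Fin (m + 1)) → ℍ × ℍ, IsSmoothSimplex σ ∧ s = toX v ∘ σ}

/-- The `i`-th face of a simplex of `𝒳`. -/
def Simplex.face {m : ℕ} (s : Simplex v (m + 1)) (i : Fin (m + 2)) : Simplex v m :=
  ⟨s.1 ∘ faceMap i, by
    obtain ⟨σ, hσ, hs⟩ := s.2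
    exact ⟨σ ∘ faceMap i, hσ.face i, by rw [hs]; rfl⟩⟩

/-- The image in `𝒳` of a simplex of `ℍ × ℍ`. -/
def UpSimplex.proj {m : ℕ} (σ : UpSimplex m) : Simplex v m :=
  ⟨toX v ∘ σ.1, σ.1, σ.2, rfl⟩

/-- `C_m(ℍ × ℍ)`: differentiable chains with integer coefficients on `ℍ × ℍ`. -/
abbrev UpChain (m : ℕ) : Type := UpSimplex m →₀ ℤ

/-- `C_m(𝒳)`: differentiable chains with integer coefficients on `𝒳`. -/
abbrev Chain (m : ℕ) : Type := Simplex v m →₀ ℤ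

/-- The boundary operator `∂ : C_{m+1}(𝒳) → C_m(𝒳)`. -/
def boundary (m : ℕ) : Chain v (m + 1) →ₗ[ℤ] Chain v m :=
  Finsupp.linearCombination ℤ fun s : Simplex v (m + 1) =>
    ∑ i : Fin (m + 2), (-1 : ℤ) ^ (i : ℕ) • Finsupp.single (s.face v i) (1 : ℤ)

theorem faceMap_faceMap {m : ℕ} (i : Fin (m + 3)) (j : Fin (m + 2)) (i' : Fin (m + 3))
    (j' : Fin (m + 2)) (h : Fin.succAbove i ∘ Fin.succAbove j = Fin.succAbove i' ∘ Fin.succAbove j') :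
    (faceMap i ∘ faceMap j : stdSimplex ℝ (Fin (m + 1)) → _) = faceMap i' ∘ faceMap j' := by
  funext x
  simp only [faceMap, Function.comp_apply, stdSimplex.map_comp_apply, h]

theorem boundary_boundary (C : Chain v 2) : boundary v 0 (boundary v 1 C) = 0 := by
  suffices h : boundary v 0 ∘ₗ boundary v 1 = 0 from LinearMap.congr_fun h C
  refine Finsupp.lhom_ext' fun s => LinearMap.ext_ring ?_
  have key : ∀ (i : Fin 3) (j : Fin 2) (i' : Fin 3) (j' : Fin 2),
      Fin.succAbove i ∘ Fin.succAbove j = Fin.succAbove i' ∘ (Fin.succAbove j' : Fin 1 → Fin 2) →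
      Simplex.face v (Simplex.face v s i) j = Simplex.face v (Simplex.face v s i') j' :=
    fun i j i' j' h => Subtype.ext (congrArg (fun g => s.1 ∘ g) (faceMap_faceMap i j i' j' h))
  have h1 := key 0 0 1 0 (by decide)
  have h2 := key 0 1 2 0 (by decide)
  have h3 := key 1 1 2 1 (by decide)
  simp [boundary, Fin.sum_univ_three, Fin.sum_univ_two, h1, h2, h3]
  abel

/-- The (surjective) map `C_m(ℍ × ℍ) → C_m(𝒳)` induced by the projection. -/
def push (m : ℕ) : UpChain m →ₗ[ℤ] Chain v m :=
  Finsupp.lmapDomain ℤ ℤ (UpSimplex.proj v)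

theorem push_surjective (m : ℕ) : Function.Surjective (push v m) := by
  have h : Function.Surjective (UpSimplex.proj v : UpSimplex m → Simplex v m) := by
    rintro ⟨s, σ, hσ, hs⟩
    exact ⟨⟨σ, hσ⟩, Subtype.ext hs.symm⟩
  exact Finsupp.mapDomain_surjective h

/-- `H₁(𝒳, ℤ) = Z₁ / B₁`, computed with differentiable chains. -/
abbrev H1 : Type :=
  LinearMap.ker (boundary v 0) ⧸
    (LinearMap.range (boundary v 1)).comap (LinearMap.ker (boundary v 0)).subtype

/-- `n_F`: the exponent of the torsion subgroup of `H₁(𝒳, ℤ)`. -/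
def nF : ℕ := AddMonoid.exponent (AddCommGroup.torsion (H1 v))

/-- The group of 1-chains on `𝒳` that are boundaries of 2-chains with rational
coefficients, that is, those with a nonzero multiple which is the boundary of an integral chain. -/
def Ctilde00 : AddSubgroup (Chain v 1) where
  carrier := {Δ | ∃ k : ℕ, k ≠ 0 ∧ ∃ C : Chain v 2, boundary v 1 C = k • Δ}
  zero_mem' := ⟨1, one_ne_zero, 0, by simp⟩
  add_mem' := by
    rintro a b ⟨k, hk, C, hC⟩ ⟨l, hl, D, hD⟩
    refine ⟨k * l, mul_ne_zero hk hl, l • C + k • D, ?_⟩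
    rw [map_add, map_nsmul, map_nsmul, hC, hD, smul_add, ← mul_smul, ← mul_smul,
      mul_comm l k]
  neg_mem' := by
    rintro a ⟨k, hk, C, hC⟩
    exact ⟨k, hk, -C, by rw [map_neg, hC, smul_neg]⟩

variable {v} in
/-- `n_F Δ` is the boundary of an integral 2-chain when `Δ` bounds rationally. -/
theorem exists_filling {Δ : Chain v 1} (h : Δ ∈ Ctilde00 v) :
    ∃ C : UpChain 2, boundary v 1 (push v 2 C) = nF v • Δ := by
  obtain ⟨k, hk, C, hC⟩ := h
  suffices h : ∃ D : Chain v 2, boundary v 1 D = nF v • Δ by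
    obtain ⟨D, hD⟩ := h
    obtain ⟨E, rfl⟩ := push_surjective v 2 D
    exact ⟨E, hD⟩
  have hΔ : Δ ∈ LinearMap.ker (boundary v 0) := by
    have h0 : k • boundary v 0 Δ = 0 := by
      rw [← map_nsmul, ← hC, boundary_boundary]
    exact (smul_eq_zero.mp h0).resolve_left hk
  let q : H1 v := Submodule.Quotient.mk ⟨Δ, hΔ⟩
  have hq : k • q = 0 := by
    rw [← Submodule.Quotient.mk_smul, Submodule.Quotient.mk_eq_zero]
    exact ⟨C, hC⟩
  have hqt : q ∈ AddCommGroup.torsion (H1 v) :=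
    isOfFinAddOrder_iff_nsmul_eq_zero.mpr ⟨k, Nat.pos_of_ne_zero hk, hq⟩
  have hn : nF v • q = 0 := by
    have := AddMonoid.exponent_nsmul_eq_zero (⟨q, hqt⟩ : AddCommGroup.torsion (H1 v))
    exact congrArg Subtype.val this
  rw [← Submodule.Quotient.mk_smul, Submodule.Quotient.mk_eq_zero] at hn
  obtain ⟨D, hD⟩ := hn
  exact ⟨D, hD⟩

end Chains

/-! ### Integration and periods -/

section Periods

/-- The triangle `{(s, t) : 0 ≤ s, 0 ≤ t, s + t ≤ 1}`. -/
def triangle : Set (ℝ × ℝ) := {p | 0 ≤ p.1 ∧ 0 ≤ p.2 ∧ p.1 + p.2 ≤ 1}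

open Classical in
/-- The parametrization `(s, t) ↦ (1 - s - t, s, t)` of the standard 2-simplex by the triangle
(with an irrelevant value outside the triangle). -/
def triPoint (p : ℝ × ℝ) : stdSimplex ℝ (Fin 3) :=
  if h : ![1 - p.1 - p.2, p.1, p.2] ∈ stdSimplex ℝ (Fin 3) then ⟨_, h⟩ else stdSimplex.vertex 0

variable {F : Type*} [Field F] [NumberField F] (v : Fin 2 → F →+* ℝ) (δ : 𝓞 F)

/-- `∫_σ ω_Eis` for a differentiable 2-simplex `σ` of `ℍ × ℍ`. -/
def integralSimplex (σ : UpSimplex 2) : ℂ :=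
  ∫ p in triangle,
    omegaEis v δ (σ.1 (triPoint p))
      (fderivWithin ℝ (fun q : ℝ × ℝ =>
        (((σ.1 (triPoint q)).1 : ℂ), ((σ.1 (triPoint q)).2 : ℂ))) triangle p (1, 0))
      (fderivWithin ℝ (fun q : ℝ × ℝ =>
        (((σ.1 (triPoint q)).1 : ℂ), ((σ.1 (triPoint q)).2 : ℂ))) triangle p (0, 1))

/-- `∫_C ω_Eis` for a 2-chain on `ℍ × ℍ`. As `ω_Eis` is `Γ`-invariant, this is also the integral
over the image of `C` in `𝒳`: integrals over a 2-chain of `𝒳` are computed on any lift. -/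
def integral : UpChain 2 →ₗ[ℤ] ℂ :=
  Finsupp.linearCombination ℤ (integralSimplex v δ)

/-- The period group `Λ_Eis`: integrals of `ω_Eis` over the closed 2-chains of `𝒳`. -/
def LambdaEis : AddSubgroup ℂ :=
  (LinearMap.ker (boundary v 1 ∘ₗ push v 2)).toAddSubgroup.map (integral v δ).toAddMonoidHom

/-- `Λ'_Eis = (1 / n_F) Λ_Eis`. -/
def LambdaEis' : AddSubgroup ℂ :=
  (LambdaEis v δ).map (AddMonoidHom.mulLeft ((nF v : ℂ)⁻¹))

/-- The Abel-Jacobi map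
`Φ_Eis(Δ) = (1 / n_F) ∫_{∂C = n_F Δ} ω_Eis` modulo `Λ'_Eis` on the group `Ctilde00` of 1-chains
that bound rationally; outside this group (which contains all closed 1-chains, because
`H₁(𝒳, ℚ) = 0`) it is extended by zero. -/
def PhiEis (Δ : Chain v 1) : ℂ ⧸ LambdaEis' v δ :=
  open Classical in
  if h : Δ ∈ Ctilde00 v then
    QuotientAddGroup.mk ((nF v : ℂ)⁻¹ * integral v δ (exists_filling h).choose)
  else 0

/-- The value of `Φ_Eis` does not depend on the chain `C` with `∂C = n_F Δ`. -/
theorem PhiEis_eq {Δ : Chain v 1} (h : Δ ∈ Ctilde00 v) (C : UpChain 2)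
    (hC : boundary v 1 (push v 2 C) = nF v • Δ) :
    PhiEis v δ Δ = QuotientAddGroup.mk ((nF v : ℂ)⁻¹ * integral v δ C) := by
  rw [PhiEis, dif_pos h, QuotientAddGroup.eq]
  refine ⟨integral v δ (C - (exists_filling h).choose), ⟨C - (exists_filling h).choose, ?_, rfl⟩, ?_⟩
  · have := (exists_filling h).choose_spec
    simp [hC, this]
  · simp [mul_sub]
    ring

end Periods

/-! ### Geodesics -/

section Geodesics

/-- The coordinate of `w` in the disc model of the hyperbolic plane centred at `z`. -/
def discCoord (z w : ℍ) : ℂ := ((w : ℂ) - z) / ((w : ℂ) - (starRingEnd ℂ) (z : ℂ))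

/-- The position at time `t`, in the disc model centred at `z`, of the geodesic with constant
speed which is at `z` at time `0` and at `w` at time `1`. -/
def discGeod (z w : ℍ) (t : ℝ) : ℂ :=
  ((Real.tanh (t * (dist z w / 2)) : ℝ) : ℂ) * (discCoord z w / (‖discCoord z w‖ : ℂ))

theorem sub_conj_ne_zero (z w : ℍ) : (w : ℂ) - (starRingEnd ℂ) (z : ℂ) ≠ 0 := by
  intro h
  have h1 := congrArg Complex.im h
  have hz := z.im_pos
  have hw := w.im_pos
  simp at h1
  linarith

theorem norm_discCoord (z w : ℍ) : ‖discCoord z w‖ = Real.tanh (dist z w / 2) := by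
  rw [dist_comm, tanh_half_dist, discCoord, norm_div, Complex.dist_eq, Complex.dist_eq]

theorem norm_discGeod_lt_one (z w : ℍ) (t : ℝ) : ‖discGeod z w t‖ < 1 := by
  rw [discGeod, norm_mul, Complex.norm_real, norm_div, Complex.norm_real, norm_norm]
  exact (mul_le_of_le_one_right (norm_nonneg _) (div_self_le_one _)).trans_lt
    (Real.abs_tanh_lt_one _)

theorem one_sub_discGeod_ne_zero (z w : ℍ) (t : ℝ) : 1 - discGeod z w t ≠ 0 := by
  intro h
  have h1 := norm_discGeod_lt_one z w t
  rw [← sub_eq_zero.mp h, norm_one] at h1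
  exact lt_irrefl _ h1

theorem im_discInv_pos (z : ℍ) {x : ℂ} (hx : ‖x‖ < 1) :
    0 < (((z : ℂ) - (starRingEnd ℂ) (z : ℂ) * x) / (1 - x)).im := by
  have h1 : 1 - x ≠ 0 := by
    intro h
    rw [← sub_eq_zero.mp h, norm_one] at hx
    exact lt_irrefl _ hx
  have h2 : 0 < Complex.normSq (1 - x) := Complex.normSq_pos.mpr h1
  have h3 : Complex.normSq x < 1 := by
    rw [Complex.normSq_eq_norm_sq]
    exact pow_lt_one₀ (norm_nonneg _) hx two_ne_zero
  have hz := z.im_pos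
  have h4 : (((z : ℂ) - (starRingEnd ℂ) (z : ℂ) * x) / (1 - x)).im =
      z.im * (1 - Complex.normSq x) / Complex.normSq (1 - x) := by
    rw [Complex.div_im, ← sub_div]
    congr 1
    simp [Complex.normSq_apply]
    ring
  rw [h4]
  exact div_pos (mul_pos hz (by linarith)) h2

/-- The constant speed geodesic `t ↦ c(t)` of `ℍ` with `c(0) = z` and `c(1) = w`: the inverse of
`x ↦ (x - z) / (x - z̄)` applied to the ray above. -/
def geod (z w : ℍ) (t : ℝ) : ℍ :=
  ⟨((z : ℂ) - (starRingEnd ℂ) (z : ℂ) * discGeod z w t) / (1 - discGeod z w t),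
    im_discInv_pos z (norm_discGeod_lt_one z w t)⟩

theorem discCoord_geod (z w : ℍ) (t : ℝ) : discCoord z (geod z w t) = discGeod z w t := by
  have h1 := one_sub_discGeod_ne_zero z w t
  have h2 := sub_conj_ne_zero z z
  have h3 : ((geod z w t : ℍ) : ℂ) =
    ((z : ℂ) - (starRingEnd ℂ) (z : ℂ) * discGeod z w t) / (1 - discGeod z w t) := rfl
  rw [discCoord, div_eq_iff (sub_conj_ne_zero z _), h3]
  field_simp
  ring

theorem dist_geod (z w : ℍ) (t : ℝ) : dist z (geod z w t) = |t| * dist z w := by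
  have h1 := norm_discCoord z (geod z w t)
  rw [discCoord_geod, discGeod, norm_mul, Complex.norm_real, norm_div, Complex.norm_real,
    norm_norm, Real.norm_eq_abs] at h1
  rcases eq_or_ne (dist z w) 0 with h | h
  · rw [h] at h1 ⊢
    simp only [zero_div, mul_zero, Real.tanh_zero, abs_zero, zero_mul] at h1
    have h2 := Real.tanh_injective (h1.symm.trans Real.tanh_zero.symm)
    linarith
  · have h2 : ‖discCoord z w‖ ≠ 0 := by
      rw [norm_discCoord]
      intro h3
      have h4 := Real.tanh_injective (h3.trans Real.tanh_zero.symm)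
      exact h (by linarith)
    rw [div_self h2, mul_one] at h1
    have h5 : |Real.tanh (t * (dist z w / 2))| = Real.tanh (|t| * (dist z w / 2)) := by
      have h6 : ∀ x : ℝ, 0 ≤ x → 0 ≤ Real.tanh x := fun x hx => by
        rw [Real.tanh_eq_sinh_div_cosh]
        exact div_nonneg (Real.sinh_nonneg_iff.mpr hx) (Real.cosh_pos x).le
      have h7 : 0 ≤ dist z w / 2 := by positivity
      rcases abs_cases t with ⟨ht, ht'⟩ | ⟨ht, ht'⟩
      · rw [ht, abs_of_nonneg (h6 _ (mul_nonneg ht' h7))]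
      · have h8 := h6 _ (mul_nonneg (neg_nonneg.mpr ht'.le) h7)
        rw [ht, neg_mul, Real.tanh_neg, abs_of_nonpos]
        rw [neg_mul, Real.tanh_neg] at h8
        linarith
    have h6 := Real.tanh_injective (h5.symm.trans h1)
    linarith

theorem discCoord_injective (z : ℍ) : Function.Injective (discCoord z) := by
  intro x y h
  have hx := sub_conj_ne_zero z x
  have hy := sub_conj_ne_zero z y
  have hz := sub_conj_ne_zero z z
  rw [discCoord, discCoord, div_eq_div_iff hx hy] at h
  have h1 : ((z : ℂ) - (starRingEnd ℂ) (z : ℂ)) * ((x : ℂ) - y) = 0 := by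
    linear_combination h
  exact UpperHalfPlane.ext (sub_eq_zero.mp ((mul_eq_zero.mp h1).resolve_left hz))

theorem geod_zero (z w : ℍ) : geod z w 0 = z := by
  have h := dist_geod z w 0
  rw [abs_zero, zero_mul] at h
  exact (dist_eq_zero.mp h).symm

theorem geod_one (z w : ℍ) : geod z w 1 = w := by
  apply discCoord_injective z
  rw [discCoord_geod, discGeod, one_mul, ← norm_discCoord]
  rcases eq_or_ne (discCoord z w) 0 with h | h
  · simp [h]
  · have : (‖discCoord z w‖ : ℂ) ≠ 0 := by simpa using h
    field_simp

theorem contDiff_geod (z w : ℍ) : ContDiff ℝ ∞ fun t => ((geod z w t : ℍ) : ℂ) := by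
  have h1 : ContDiff ℝ ∞ fun t : ℝ => Real.tanh (t * (dist z w / 2)) := by
    simp only [Real.tanh_eq_sinh_div_cosh]
    exact ContDiff.div (by fun_prop) (by fun_prop) fun t => (Real.cosh_pos _).ne'
  have h2 : ContDiff ℝ ∞ fun t : ℝ => discGeod z w t :=
    (Complex.ofRealCLM.contDiff.comp h1).mul contDiff_const
  exact (contDiff_const.sub (contDiff_const.mul h2)).mul
    ((contDiff_const.sub h2).inv (one_sub_discGeod_ne_zero z w))

/-- The differentiable 1-simplex of `ℍ × ℍ` given by a `C^∞` path restricted to `[0, 1]`. -/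
def pathSimplex (c : ℝ → ℍ × ℍ) (h₁ : ContDiff ℝ ∞ fun t => ((c t).1 : ℂ))
    (h₂ : ContDiff ℝ ∞ fun t => ((c t).2 : ℂ)) : UpSimplex 1 :=
  ⟨fun x => c (x 1), fun x => (((c (x 1)).1 : ℂ), ((c (x 1)).2 : ℂ)),
    (h₁.comp (contDiff_apply ℝ ℝ 1)).prodMk (h₂.comp (contDiff_apply ℝ ℝ 1)), fun _ => rfl⟩

/-- The geodesic path of `ℍ × ℍ` from `P` to `Q`. -/
def geodSimplex (P Q : ℍ × ℍ) : UpSimplex 1 :=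
  pathSimplex (fun t => (geod P.1 Q.1 t, geod P.2 Q.2 t))
    (contDiff_geod P.1 Q.1) (contDiff_geod P.2 Q.2)

theorem upsilon_denom_ne_zero (t : ℝ) : (Real.exp t : ℂ) * Complex.I + 1 ≠ 0 := by
  intro h
  have := congrArg Complex.re h
  simp [-Complex.ofReal_exp] at this

/-- For real `r < r'`, the arc length parametrization of the geodesic of `ℍ` joining `r` to `r'`,
oriented from `r` (at `t = -∞`) to `r'` (at `t = +∞`). -/
def upsilon (r r' : ℝ) (h : r < r') (t : ℝ) : ℍ :=
  ⟨((r' : ℂ) * (Real.exp t * Complex.I) + r) / (Real.exp t * Complex.I + 1), by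
    have h2 := Complex.normSq_pos.mpr (upsilon_denom_ne_zero t)
    have h4 : (((r' : ℂ) * (Real.exp t * Complex.I) + r) / (Real.exp t * Complex.I + 1)).im =
        Real.exp t * (r' - r) / Complex.normSq (Real.exp t * Complex.I + 1) := by
      rw [Complex.div_im, ← sub_div]
      congr 1
      simp [-Complex.ofReal_exp]
      ring
    rw [h4]
    exact div_pos (mul_pos (Real.exp_pos t) (sub_pos.mpr h)) h2⟩

theorem contDiff_upsilon (r r' : ℝ) (h : r < r') :
    ContDiff ℝ ∞ fun t => ((upsilon r r' h t : ℍ) : ℂ) := by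
  have h1 : ContDiff ℝ ∞ fun t : ℝ => (Real.exp t : ℂ) * Complex.I :=
    (Complex.ofRealCLM.contDiff.comp Real.contDiff_exp).mul contDiff_const
  exact ((contDiff_const.mul h1).add contDiff_const).mul
    ((h1.add contDiff_const).inv upsilon_denom_ne_zero)

end Geodesics

/-! ### The cocycle side and the cycle attached to `τ` -/

section Main

variable {F : Type*} [Field F]

/-- `S_P(A)`: the image in `𝒳` of the geodesic path from `P` to `A P`. -/
def SP (v : Fin 2 → F →+* ℝ) (P : ℍ × ℍ) (A : SL(2, 𝓞 F)) : Chain v 1 :=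
  Finsupp.single ((geodSimplex P (act v A P)).proj v) 1

/-- `ρ_P(A) = (1 / n_F) ∫_{D_P(A)} ω_Eis` modulo `Λ'_Eis`, where `∂ D_P(A) = n_F S_P(A)`. -/
def rhoP [NumberField F] (v : Fin 2 → F →+* ℝ) (δ : 𝓞 F) (P : ℍ × ℍ) (A : SL(2, 𝓞 F)) :
    ℂ ⧸ LambdaEis' v δ :=
  PhiEis v δ (SP v P A)

variable {K : Type*} [Field K] [Algebra F K]

/-- The image in `K` of an entry of a matrix of `Γ`. -/
def entry (K : Type*) [Field K] [Algebra F K] (A : SL(2, 𝓞 F)) (i j : Fin 2) : K :=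
  algebraMap F K ((A i j : 𝓞 F) : F)

variable (F) in
/-- `Γ_τ`: the stabilizer in `Γ` of `τ ∈ K` for the action by homographies
(`(a τ + b) / (c τ + d) = τ`). -/
def GammaTau (τ : K) : Subgroup SL(2, 𝓞 F) where
  carrier := {A | entry K A 0 0 * τ + entry K A 0 1 =
    τ * (entry K A 1 0 * τ + entry K A 1 1)}
  one_mem' := by simp [entry]
  mul_mem' := by
    intro A B hA hB
    simp only [Set.mem_ofPred_eq, entry, Matrix.SpecialLinearGroup.coe_mul, Matrix.mul_apply,
      Fin.sum_univ_two, map_add, map_mul] at hA hB ⊢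
    linear_combination (algebraMap F K (B 1 0 : 𝓞 F) * τ + algebraMap F K (B 1 1 : 𝓞 F)) * hA +
      (algebraMap F K (A 0 0 : 𝓞 F) - τ * algebraMap F K (A 1 0 : 𝓞 F)) * hB
  inv_mem' := by
    intro A hA
    simp only [Set.mem_ofPred_eq, entry, Matrix.SpecialLinearGroup.coe_inv,
      Matrix.adjugate_fin_two] at hA ⊢
    simp
    linear_combination -hA

/-- `γ` generates `Γ_τ` modulo torsion. -/
def IsGeneratorModTorsion (τ : K) (γ : SL(2, 𝓞 F)) : Prop :=
  γ ∈ GammaTau F τ ∧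
    ∀ A ∈ GammaTau F τ, ∃ k : ℤ, IsOfFinOrder (γ ^ (-k) * A)

/-- A parametrization of `R_τ = {τ₁} × Υ₂` where `Υ₂` is the geodesic joining `r` to `r'`. -/
def Rtau (τ₁ : ℍ) (r r' : ℝ) (h : r < r') (t : ℝ) : ℍ × ℍ := (τ₁, upsilon r r' h t)

/-- The arc `R_τ([a, b))`, `a < b`, is a fundamental domain for the action of `Γ_τ` on `R_τ`. -/
def IsFundamentalArc (v : Fin 2 → F →+* ℝ) (τ : K) (τ₁ : ℍ) (r r' : ℝ) (h : r < r')
    (a b : ℝ) : Prop :=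
  a < b ∧ ∀ t : ℝ, ∃! s : ℝ, s ∈ Set.Ico a b ∧
    ∃ A ∈ GammaTau F τ, act v A (Rtau τ₁ r r' h t) = Rtau τ₁ r r' h s

/-- The 1-chain `Δ_τ` on `𝒳`: the image of the arc `R_τ([a, b])`, oriented as `Υ₂`. -/
def DeltaTau (v : Fin 2 → F →+* ℝ) (τ₁ : ℍ) (r r' : ℝ) (h : r < r') (a b : ℝ) : Chain v 1 :=
  Finsupp.single ((pathSimplex (fun t => Rtau τ₁ r r' h (a + t * (b - a)))
    (contDiff_const (c := (τ₁ : ℂ))) ((contDiff_upsilon r r' h).comp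
      (contDiff_const.add (contDiff_id.mul contDiff_const)))).proj v) 1

end Main

end HilbertEis

end

open scoped NumberField MatrixGroups ContDiff

noncomputable section

namespace HilbertEis

open UpperHalfPlane

/-! ### The geodesic `Υ` and its translations -/

section Upsilon

variable {r r' : ℝ} (h : r < r')

/-! The whole comparison takes place on the curve `{τ₁} × Υ₂`, parametrized by arc length. An
element of `Γ_τ` fixes `τ₁` at the complex place and both end points of `Υ₂` at the real ones, so it
translates the curve (`exists_translation_of_fixes`). By positivity `γ` translates by some `l > 0`.
Elements of finite order do not move the curve, so `Γ_τ` acts through the multiples of `l`, and a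
fundamental arc has length exactly `l` (`sub_eq_of_existsUnique_Ico`).

Since `P` lies on the curve, the geodesic path from `P` to `γ P` is also an arc of length `l`:
constant in the first factor and a constant speed segment of `Υ₂` in the second (`geod_upsilon`).
The two chains to compare are thus arcs `[a, a + l]` and `[t₀, t₀ + l]` of one curve whose times `t`
and `t + l` agree in `𝒳`. They differ by the boundary of two degenerate triangles on the curve
(`boundary_affineSimplex_sub`). The form `ω_Eis` vanishes identically on such triangles, because
their tangent vectors are real multiples of a single vertical vector
(`integralSimplex_affineSimplex`). Neither closedness nor any property of `E₂` enters this
vanishing. -/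

theorem coe_upsilon (t : ℝ) :
    (upsilon r r' h t : ℂ) =
      ((r' : ℂ) * (Real.exp t * Complex.I) + r) / (Real.exp t * Complex.I + 1) := rfl

theorem upsilon_injective : Function.Injective (upsilon r r' h) := by
  intro s t hst
  have h1 := congrArg (fun z : ℍ => (z : ℂ)) hst
  simp only [coe_upsilon] at h1
  rw [div_eq_div_iff (upsilon_denom_ne_zero s) (upsilon_denom_ne_zero t)] at h1
  have h2 : ((r' : ℂ) - r) ≠ 0 := sub_ne_zero.mpr (by exact_mod_cast h.ne')
  have h3 : ((r' : ℂ) - r) * Complex.I * ((Real.exp s : ℂ) - Real.exp t) = 0 := by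
    linear_combination h1
  have h4 := (mul_eq_zero.mp h3).resolve_left (mul_ne_zero h2 Complex.I_ne_zero)
  exact Real.exp_injective (by exact_mod_cast sub_eq_zero.mp h4)

/-- An element of `SL₂(ℝ)` fixing both end points of a geodesic translates along it. -/
theorem exists_translation_of_fixes {g : SL(2, ℝ)}
    (hr : g 0 0 * r + g 0 1 = r * (g 1 0 * r + g 1 1))
    (hr' : g 0 0 * r' + g 0 1 = r' * (g 1 0 * r' + g 1 1)) :
    ∃ s : ℝ, ∀ t : ℝ, g • upsilon r r' h t = upsilon r r' h (t + s) := by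
  have hdet : g 0 0 * g 1 1 - g 0 1 * g 1 0 = 1 := by
    rw [← Matrix.det_fin_two]; exact g.2
  -- The vectors `(r, 1)` and `(r', 1)` are eigenvectors of `g`, with eigenvalues `c r + d` and `c
  -- r' + d`; their product is the determinant.
  have hprod : (g 1 0 * r + g 1 1) * (g 1 0 * r' + g 1 1) = 1 := by
    have h1 : (r' - r) * ((g 1 0 * r + g 1 1) * (g 1 0 * r' + g 1 1) - 1) = 0 := by
      linear_combination (r' - r) * hdet - (g 1 0 * r + g 1 1) * hr' +
        (g 1 0 * r' + g 1 1) * hr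
    exact sub_eq_zero.mp ((mul_eq_zero.mp h1).resolve_left (sub_ne_zero.mpr h.ne'))
  have hne' : g 1 0 * r' + g 1 1 ≠ 0 := right_ne_zero_of_mul_eq_one hprod
  -- In the coordinate `E = i e^t`, which sends `r` to `0` and `r'` to `∞`, `g` is multiplication by
  -- the ratio of the eigenvalues. As their product is `1`, the ratio is the square of the one at
  -- `r'`.
  refine ⟨Real.log ((g 1 0 * r' + g 1 1) ^ 2), fun t => UpperHalfPlane.ext ?_⟩
  have hden : (g 1 0 : ℂ) * (upsilon r r' h t : ℂ) + g 1 1 ≠ 0 := by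
    simpa [denom] using denom_ne_zero g (upsilon r r' h t)
  have hE := upsilon_denom_ne_zero t
  have hE' := upsilon_denom_ne_zero (t + Real.log ((g 1 0 * r' + g 1 1) ^ 2))
  rw [coe_specialLinearGroup_apply]
  simp only [Algebra.algebraMap_self, RingHom.id_apply]
  rw [coe_upsilon h (t + _), div_eq_div_iff hden hE']
  rw [Real.exp_add, Real.exp_log (by positivity), coe_upsilon]
  have hrC : (g 0 0 : ℂ) * r + g 0 1 = r * (g 1 0 * r + g 1 1) := by exact_mod_cast hr
  have hrC' : (g 0 0 : ℂ) * r' + g 0 1 = r' * (g 1 0 * r' + g 1 1) := by exact_mod_cast hr'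
  have hprodC : ((g 1 0 : ℂ) * r + g 1 1) * (g 1 0 * r' + g 1 1) = 1 := by
    exact_mod_cast hprod
  generalize hEE : (Real.exp t : ℂ) * Complex.I = E at hE
  push_cast [-Complex.ofReal_exp]
  have hcomm : (Real.exp t : ℂ) * ((g 1 0 : ℂ) * r' + g 1 1) ^ 2 * Complex.I =
      ((g 1 0 : ℂ) * r' + g 1 1) ^ 2 * E := by rw [← hEE]; ring
  rw [hcomm]
  generalize (g 0 0 : ℂ) = p at *
  generalize (g 0 1 : ℂ) = q at *
  generalize (g 1 0 : ℂ) = c at *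
  generalize (g 1 1 : ℂ) = d at *
  have hnum : p * ((r' * E + r) / (E + 1)) + q =
      (r' * (c * r' + d) * E + r * (c * r + d)) / (E + 1) := by
    rw [eq_div_iff hE]
    field_simp
    linear_combination E * hrC' + hrC
  have hdenom : c * ((r' * E + r) / (E + 1)) + d =
      ((c * r' + d) * E + (c * r + d)) / (E + 1) := by
    rw [eq_div_iff hE]
    field_simp
    ring
  rw [hnum, hdenom]
  field_simp
  linear_combination ((r : ℂ) - r') * (c * r' + d) * E * hprodC

/-- Seen in the disc centred at one of its points, `Υ` is a diameter. The unit vector `u` gives its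
direction and does not depend on `s`, which may have either sign. -/
theorem exists_discCoord_upsilon (t : ℝ) :
    ∃ u : ℂ, ‖u‖ = 1 ∧ ∀ s : ℝ,
      discCoord (upsilon r r' h t) (upsilon r r' h (t + s)) = (Real.tanh (s / 2) : ℂ) * u := by
  have hE := upsilon_denom_ne_zero t
  have hE' : -((Real.exp t : ℂ) * Complex.I) + 1 ≠ 0 := fun h0 =>
    hE (by simpa [-Complex.ofReal_exp] using congrArg (starRingEnd ℂ) h0)
  have hconj : (starRingEnd ℂ) ((Real.exp t : ℂ) * Complex.I + 1) =
      -((Real.exp t : ℂ) * Complex.I) + 1 := by simp [-Complex.ofReal_exp]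
  -- With `E = i e^t`, conjugation changes `E` to `-E`, so this quotient is a conjugate over its
  -- original and has norm `1`.
  refine ⟨(-((Real.exp t : ℂ) * Complex.I) + 1) / ((Real.exp t : ℂ) * Complex.I + 1), ?_,
    fun s => ?_⟩
  · rw [← hconj, norm_div, Complex.norm_conj, div_self (norm_ne_zero_iff.mpr hE)]
  have htanh : Real.tanh (s / 2) = (Real.exp s - 1) / (Real.exp s + 1) := by
    have h1 := Real.exp_pos (s / 2)
    have h2 : Real.exp s = Real.exp (s / 2) ^ 2 := by
      rw [← Real.exp_nat_mul]; congr 1; push_cast; ring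
    rw [Real.tanh_eq_sinh_div_cosh, Real.sinh_eq, Real.cosh_eq, Real.exp_neg, h2]
    field_simp
  have hs : (Real.exp s : ℂ) + 1 ≠ 0 := by
    exact_mod_cast (by positivity : Real.exp s + 1 ≠ 0)
  have hts := upsilon_denom_ne_zero (t + s)
  have hsub := sub_conj_ne_zero (upsilon r r' h t) (upsilon r r' h (t + s))
  have hconjz : (starRingEnd ℂ) (upsilon r r' h t : ℂ) =
      ((r' : ℂ) * -((Real.exp t : ℂ) * Complex.I) + r) /
        (-((Real.exp t : ℂ) * Complex.I) + 1) := by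
    rw [coe_upsilon, map_div₀, hconj]
    simp [-Complex.ofReal_exp]
  rw [discCoord, div_eq_iff hsub, hconjz, coe_upsilon, coe_upsilon, htanh]
  rw [Real.exp_add] at hts ⊢
  push_cast [-Complex.ofReal_exp] at hts ⊢
  generalize (Real.exp s : ℂ) = S at *
  generalize (Real.exp t : ℂ) = T at *
  field_simp
  ring

/-- `Υ` is parametrized by arc length. -/
theorem dist_upsilon (t : ℝ) {s : ℝ} (hs : 0 ≤ s) :
    dist (upsilon r r' h t) (upsilon r r' h (t + s)) = s := by
  obtain ⟨u, hu, hd⟩ := exists_discCoord_upsilon h t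
  have h1 := norm_discCoord (upsilon r r' h t) (upsilon r r' h (t + s))
  have h2 : 0 ≤ Real.tanh (s / 2) := by
    rw [Real.tanh_eq_sinh_div_cosh]
    exact div_nonneg (Real.sinh_nonneg_iff.mpr (by linarith)) (Real.cosh_pos _).le
  rw [hd, norm_mul, hu, mul_one, Complex.norm_real, Real.norm_eq_abs, abs_of_nonneg h2] at h1
  linarith [Real.tanh_injective h1]

/-- Both sides have disc coordinate `tanh (x l / 2) u`. The agreement is one of parametrized paths,
as needed for an equality of singular simplices rather than of homology classes. -/
theorem geod_upsilon (t x : ℝ) {l : ℝ} (hl : 0 < l) :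
    geod (upsilon r r' h t) (upsilon r r' h (t + l)) x = upsilon r r' h (t + x * l) := by
  obtain ⟨u, hu, hd⟩ := exists_discCoord_upsilon h t
  have hne : (Real.tanh (l / 2) : ℂ) ≠ 0 := by
    rw [Complex.ofReal_ne_zero, ← Real.tanh_zero]
    exact fun h0 => by linarith [Real.tanh_injective h0]
  apply discCoord_injective (upsilon r r' h t)
  rw [discCoord_geod, discGeod, norm_discCoord, dist_upsilon h t hl.le, hd, hd,
    mul_div_assoc]
  field_simp

end Upsilon

theorem geod_self (z : ℍ) (t : ℝ) : geod z z t = z := by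
  have h := dist_geod z z t
  rw [dist_self, mul_zero] at h
  exact (dist_eq_zero.mp h).symm

/-! ### Affine simplices on a path -/

section AffineSimplex

/-- This reconciles barycentric coordinates with the time `x 1` used by `pathSimplex`. -/
theorem sum_mul_vecCons_add (x : stdSimplex ℝ (Fin 2)) (a l : ℝ) :
    ∑ i, x i * (![a, a + l] : Fin 2 → ℝ) i = a + x 1 * l := by
  have hx := stdSimplex.sum_eq_one x
  rw [Fin.sum_univ_two] at hx ⊢
  simp only [Matrix.cons_val]
  linear_combination a * hx

/-- The affine simplex of the path `c` with vertices at the times `y i`. -/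
def affineSimplex {m : ℕ} (c : ℝ → ℍ × ℍ) (h₁ : ContDiff ℝ ∞ fun t => ((c t).1 : ℂ))
    (h₂ : ContDiff ℝ ∞ fun t => ((c t).2 : ℂ)) (y : Fin (m + 1) → ℝ) : UpSimplex m :=
  ⟨fun x => c (∑ i, x i * y i),
    fun x => (((c (∑ i, x i * y i)).1 : ℂ), ((c (∑ i, x i * y i)).2 : ℂ)),
    (h₁.comp (by fun_prop)).prodMk (h₂.comp (by fun_prop)), fun _ => rfl⟩

variable {F : Type*} [Field F] (v : Fin 2 → F →+* ℝ) {c : ℝ → ℍ × ℍ}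
  (h₁ : ContDiff ℝ ∞ fun t => ((c t).1 : ℂ)) (h₂ : ContDiff ℝ ∞ fun t => ((c t).2 : ℂ))

/-- The face inclusion inserts a zero as `i`-th barycentric coordinate, so the vertex `y i` drops
out of the sum. -/
theorem face_affineSimplex {m : ℕ} (y : Fin (m + 2) → ℝ) (i : Fin (m + 2)) :
    ((affineSimplex c h₁ h₂ y).proj v).face v i =
      (affineSimplex c h₁ h₂ (y ∘ i.succAbove)).proj v := by
  refine Subtype.ext (funext fun x => congrArg (fun t => toX v (c t)) ?_)
  change ∑ j, FunOnFinite.linearMap ℝ ℝ i.succAbove x j * y j = _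
  rw [Fin.sum_univ_succAbove _ i]
  simp only [FunOnFinite.linearMap_apply_apply]
  simp [Fin.succAbove_ne, Finset.filter_eq']

/-- Barycentric coordinates sum to one, so shifting every vertex by `l` shifts the time by `l`, and
`A` identifies the two points in the quotient. -/
theorem proj_affineSimplex_add {A : SL(2, 𝓞 F)} {l : ℝ}
    (hA : ∀ t, act v A (c t) = c (t + l)) {m : ℕ} (y : Fin (m + 1) → ℝ) :
    (affineSimplex c h₁ h₂ (fun i => y i + l)).proj v = (affineSimplex c h₁ h₂ y).proj v := by
  refine Subtype.ext (funext fun x => (Quotient.sound ⟨A, ?_⟩ : toX v _ = toX v _).symm)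
  change act v A (c (∑ i, x i * y i)) = c (∑ i, x i * (y i + l))
  simp only [mul_add, Finset.sum_add_distrib, ← Finset.sum_mul, stdSimplex.sum_eq_one, one_mul, hA]

theorem boundary_affineSimplex (y : Fin 3 → ℝ) :
    boundary v 1 (push v 2 (Finsupp.single (affineSimplex c h₁ h₂ y) 1)) =
      Finsupp.single ((affineSimplex c h₁ h₂ ![y 1, y 2]).proj v) 1 -
      Finsupp.single ((affineSimplex c h₁ h₂ ![y 0, y 2]).proj v) 1 +
      Finsupp.single ((affineSimplex c h₁ h₂ ![y 0, y 1]).proj v) 1 := by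
  have e0 : y ∘ Fin.succAbove 0 = ![y 1, y 2] := by ext i; fin_cases i <;> rfl
  have e1 : y ∘ Fin.succAbove 1 = ![y 0, y 2] := by ext i; fin_cases i <;> rfl
  have e2 : y ∘ Fin.succAbove 2 = ![y 0, y 1] := by ext i; fin_cases i <;> rfl
  simp only [push, Finsupp.lmapDomain_apply, Finsupp.mapDomain_single, boundary,
    Finsupp.linearCombination_single, one_smul, face_affineSimplex]
  rw [Fin.sum_univ_three, e0, e1, e2]
  simp [sub_eq_add_neg]

/-- If `A ∈ Γ` translates the path `c` by `l`, any two arcs of length `l` differ by the boundary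
of a chain of affine simplices of `c`. -/
theorem boundary_affineSimplex_sub {A : SL(2, 𝓞 F)} {l : ℝ}
    (hA : ∀ t, act v A (c t) = c (t + l)) (a t : ℝ) :
    boundary v 1 (push v 2 (Finsupp.single (affineSimplex c h₁ h₂ ![a, a + l, t + l]) 1 -
        Finsupp.single (affineSimplex c h₁ h₂ ![a, t, t + l]) 1)) =
      Finsupp.single ((affineSimplex c h₁ h₂ ![a, a + l]).proj v) 1 -
        Finsupp.single ((affineSimplex c h₁ h₂ ![t, t + l]).proj v) 1 := by
  -- The two triangles share the diagonal `[a, t + l]`, which cancels. The sides `[a, t]` and `[a +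
  -- l, t + l]` cancel because they coincide in `𝒳`. No order between `a` and `t` is needed.
  have e : (fun i => (![a, t] : Fin 2 → ℝ) i + l) = ![a + l, t + l] := by
    ext i; fin_cases i <;> rfl
  have h := proj_affineSimplex_add v h₁ h₂ hA ![a, t]
  rw [e] at h
  rw [map_sub, map_sub, boundary_affineSimplex, boundary_affineSimplex]
  simp only [Matrix.cons_val, h]
  abel

end AffineSimplex

/-! ### Integration over chains contained in a path -/

section Integration

/-- This makes `fderivWithin` on the closed triangle computable from any derivative, boundary points
included. -/
theorem uniqueDiffOn_triangle : UniqueDiffOn ℝ triangle := by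
  refine uniqueDiffOn_convex ?_ ⟨(1 / 4, 1 / 4), ?_⟩
  · rintro p ⟨hp1, hp2, hp3⟩ q ⟨hq1, hq2, hq3⟩ s t hs ht hst
    refine ⟨?_, ?_, ?_⟩ <;> simp only [Prod.fst_add, Prod.snd_add, Prod.smul_fst, Prod.smul_snd,
      smul_eq_mul]
    · positivity
    · positivity
    · nlinarith
  · rw [mem_interior]
    refine ⟨{p | 0 < p.1} ∩ {p | 0 < p.2} ∩ {p | p.1 + p.2 < 1},
      fun p hp => ⟨hp.1.1.le, hp.1.2.le, le_of_lt hp.2⟩, ?_, ?_⟩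
    · exact ((isOpen_lt (by fun_prop) (by fun_prop)).inter
        (isOpen_lt (by fun_prop) (by fun_prop))).inter (isOpen_lt (by fun_prop) (by fun_prop))
    · norm_num

theorem coe_triPoint {p : ℝ × ℝ} (hp : p ∈ triangle) :
    (triPoint p : Fin 3 → ℝ) = ![1 - p.1 - p.2, p.1, p.2] := by
  have h : ![1 - p.1 - p.2, p.1, p.2] ∈ stdSimplex ℝ (Fin 3) := by
    obtain ⟨h1, h2, h3⟩ := hp
    refine ⟨fun i => ?_, by simp [Fin.sum_univ_three]; ring⟩
    fin_cases i
    · change 0 ≤ 1 - p.1 - p.2; linarith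
    · exact h1
    · exact h2
  rw [triPoint, dif_pos h]
  rfl

variable {F : Type*} [Field F] [NumberField F] (v : Fin 2 → F →+* ℝ) (δ : 𝓞 F)

/-- `ω_Eis` vanishes on pairs of vectors that are vertical and real multiples of each other. -/
theorem omegaEis_eq_zero (z : ℍ × ℍ) (d : ℂ) (x y : ℝ) :
    omegaEis v δ z (x • ((0 : ℂ), d)) (y • ((0 : ℂ), d)) = 0 := by
  simp [omegaEis]
  right; left
  ring

/-- The integral of `ω_Eis` over an affine simplex of a path with constant first coordinate
vanishes. -/
theorem integralSimplex_affineSimplex {c : ℝ → ℍ × ℍ} {z₁ : ℍ} (hc : ∀ t, (c t).1 = z₁)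
    (h₁ : ContDiff ℝ ∞ fun t => ((c t).1 : ℂ)) (h₂ : ContDiff ℝ ∞ fun t => ((c t).2 : ℂ))
    (y : Fin 3 → ℝ) : integralSimplex v δ (affineSimplex c h₁ h₂ y) = 0 := by
  refine MeasureTheory.setIntegral_eq_zero_of_forall_eq_zero fun p hp => ?_
  -- On the triangle the simplex factors as `c ∘ L`, so both partial derivatives are real multiples
  -- of the velocity of `c`, whose first component is zero.
  let L : ℝ × ℝ → ℝ := fun q => (1 - q.1 - q.2) * y 0 + q.1 * y 1 + q.2 * y 2
  have hL : DifferentiableAt ℝ L p := by fun_prop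
  have hσ : ∀ q ∈ triangle, (affineSimplex c h₁ h₂ y).1 (triPoint q) = c (L q) := by
    intro q hq
    change c (∑ i, triPoint q i * y i) = _
    rw [Fin.sum_univ_three, coe_triPoint hq]
    rfl
  have hd : HasDerivAt (fun t => (((c t).1 : ℂ), ((c t).2 : ℂ)))
      ((0 : ℂ), deriv (fun t => ((c t).2 : ℂ)) (L p)) (L p) := by
    refine HasDerivAt.prodMk ?_ ((h₂.differentiable (by simp)) (L p)).hasDerivAt
    simp only [hc]
    exact hasDerivAt_const _ _
  have hf := ((hd.hasFDerivAt.comp p hL.hasFDerivAt).hasFDerivWithinAt (s := triangle)).congr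
    (f₁ := fun q => ((((affineSimplex c h₁ h₂ y).1 (triPoint q)).1 : ℂ),
      (((affineSimplex c h₁ h₂ y).1 (triPoint q)).2 : ℂ)))
    (fun q hq => by simp only [hσ q hq, Function.comp_apply])
    (by simp only [hσ p hp, Function.comp_apply])
  rw [hf.fderivWithin (uniqueDiffOn_triangle p hp)]
  exact omegaEis_eq_zero v δ _ _ _ _

/-- `Φ_Eis` takes the same value on chains that differ by the boundary of a chain over which
`ω_Eis` integrates to zero. -/
theorem PhiEis_eq_of_boundary {Δ Δ' : Chain v 1} (D : UpChain 2)
    (hD : boundary v 1 (push v 2 D) = Δ - Δ') (hD0 : integral v δ D = 0) :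
    PhiEis v δ Δ = PhiEis v δ Δ' := by
  have hmem : Δ - Δ' ∈ Ctilde00 v := ⟨1, one_ne_zero, push v 2 D, by rw [hD, one_smul]⟩
  by_cases h' : Δ' ∈ Ctilde00 v
  · have h : Δ ∈ Ctilde00 v := by simpa using add_mem hmem h'
    obtain ⟨C, hC⟩ := exists_filling h'
    -- Adding `n_F D` to a filling of `n_F Δ'` gives a filling of `n_F Δ` with the same integral.
    rw [PhiEis_eq v δ h' C hC, PhiEis_eq v δ h (C + nF v • D)]
    · rw [map_add, map_nsmul, hD0, smul_zero, add_zero]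
    · rw [map_add, map_add, map_nsmul, map_nsmul, hC, hD, ← smul_add, add_sub_cancel]
  -- If one chain does not bound rationally, neither does the other, and both values are the default
  -- `0`.
  · have h : Δ ∉ Ctilde00 v := fun h => h' (by simpa using sub_mem h hmem)
    rw [PhiEis, PhiEis, dif_neg h, dif_neg h']

end Integration

/-! ### The action of `Γ_τ` on `{τ₁} × Υ₂` -/

section Stabilizer

variable {F : Type*} [Field F] {v : Fin 2 → F →+* ℝ} {K : Type*} [Field K] [Algebra F K]
  {τ : K} {A : SL(2, 𝓞 F)}

/-- Applying `w` to the fixed point equation of `τ` turns it into that of `z`; the denominator does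
not vanish on `ℍ`. -/
theorem embSL_smul_of_mem_GammaTau (hA : A ∈ GammaTau F τ) {φ : F →+* ℝ} (w : K →+* ℂ)
    (hw : ∀ x : F, w (algebraMap F K x) = ((φ x : ℝ) : ℂ)) {z : ℍ} (hz : (z : ℂ) = w τ) :
    embSL φ A • z = z := by
  have h := congrArg w hA
  simp only [entry, map_add, map_mul, hw, ← hz] at h
  have hden : (embSL φ A 1 0 : ℂ) * (z : ℂ) + embSL φ A 1 1 ≠ 0 := by
    simpa [denom] using denom_ne_zero (embSL φ A) z
  apply UpperHalfPlane.ext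
  rw [coe_specialLinearGroup_apply]
  simp only [Algebra.algebraMap_self, RingHom.id_apply]
  rw [div_eq_iff hden]
  exact h

/-- The equation is kept free of division, since a real point may a priori be a pole. It supplies
the end point conditions for `exists_translation_of_fixes`. -/
theorem embSL_fixes_of_mem_GammaTau (hA : A ∈ GammaTau F τ) {φ : F →+* ℝ} (w : K →+* ℝ)
    (hw : ∀ x : F, w (algebraMap F K x) = φ x) :
    embSL φ A 0 0 * w τ + embSL φ A 0 1 = w τ * (embSL φ A 1 0 * w τ + embSL φ A 1 1) := by
  have h := congrArg w hA
  simp only [entry, map_add, map_mul, hw] at h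
  exact h

/-- A half-open interval that is a fundamental domain for the translations of `ℝ` by the multiples
of `l > 0` has length `l`. -/
theorem sub_eq_of_existsUnique_Ico {a b l : ℝ} (hl : 0 < l) (hab : a < b)
    (h : ∀ t : ℝ, ∃! s : ℝ, s ∈ Set.Ico a b ∧ ∃ k : ℤ, s = t + k * l) : b - a = l := by
  rcases lt_trichotomy (b - a) l with hlt | heq | hgt
  -- Too short an interval: a translate of `b` in `[a, b)` would force `-1 < k < 0`.
  · obtain ⟨s, ⟨⟨hs1, hs2⟩, k, hk⟩, -⟩ := h b
    have h1 : (k : ℝ) * l < 0 := by linarith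
    have h2 : (-1 : ℝ) * l < k * l := by linarith
    have h3 : k < 0 := by
      by_contra! h0
      have : (0 : ℝ) ≤ k := by exact_mod_cast h0
      nlinarith
    have h4 : (-1 : ℤ) < k := by exact_mod_cast lt_of_mul_lt_mul_right h2 hl.le
    omega
  · exact heq
  -- Too long an interval: `a` and `a + l` are two representatives of `a`.
  · have h1 := (h a).unique (y₁ := a) (y₂ := a + l) ⟨⟨le_rfl, hab⟩, 0, by simp⟩
      ⟨⟨by linarith, by linarith⟩, 1, by simp⟩
    linarith

variable {r r' : ℝ} {h : r < r'}

theorem pow_smul_upsilon {g : SL(2, ℝ)} {s : ℝ}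
    (hg : ∀ t, g • upsilon r r' h t = upsilon r r' h (t + s)) (n : ℕ) (t : ℝ) :
    g ^ n • upsilon r r' h t = upsilon r r' h (t + n * s) := by
  induction n generalizing t with
  | zero => simp
  | succ n ih =>
    rw [pow_succ, mul_smul, hg, ih]
    congr 1
    push_cast
    ring

theorem zpow_smul_upsilon {g : SL(2, ℝ)} {s : ℝ}
    (hg : ∀ t, g • upsilon r r' h t = upsilon r r' h (t + s)) (k : ℤ) (t : ℝ) :
    g ^ k • upsilon r r' h t = upsilon r r' h (t + k * s) := by
  obtain ⟨n, rfl | rfl⟩ := k.eq_nat_or_neg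
  · simpa using pow_smul_upsilon hg n t
  · rw [zpow_neg, zpow_natCast, inv_smul_eq_iff, pow_smul_upsilon hg]
    congr 1
    push_cast
    ring

/-- An element of finite order that translates `Υ` fixes it pointwise. -/
theorem translation_eq_zero_of_isOfFinOrder {g : SL(2, ℝ)} {s : ℝ}
    (hg : ∀ t, g • upsilon r r' h t = upsilon r r' h (t + s)) (hfin : IsOfFinOrder g) :
    s = 0 := by
  obtain ⟨n, hn, hgn⟩ := isOfFinOrder_iff_pow_eq_one.mp hfin
  have h1 := pow_smul_upsilon hg n 0
  rw [hgn, one_smul] at h1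
  have h2 := upsilon_injective h h1
  have h3 : (n : ℝ) ≠ 0 := by exact_mod_cast hn.ne'
  have h4 : (n : ℝ) * s = 0 := by linarith
  exact (mul_eq_zero.mp h4).resolve_left h3

end Stabilizer

end HilbertEis

end

/-! ### Comparison of the cycle of `τ` with the geodesic path of `γ` -/

theorem mainTheorem12
    {F : Type*} [Field F] [NumberField F] (hF : Module.finrank ℚ F = 2)
    (v : Fin 2 → F →+* ℝ) (hv : Function.Injective v)
    (hcl : HilbertEis.NarrowClassNumberOne v)
    (δ : NumberField.RingOfIntegers F) (hδ : HilbertEis.IsPosDifferentGenerator v δ)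
    {K : Type*} [Field K] [Algebra F K] (hK : Module.finrank F K = 2)
    (w₁ : K →+* ℂ) (hw₁ : ∀ x : F, w₁ (algebraMap F K x) = ((v 0 x : ℝ) : ℂ))
    (w₂ w₂' : K →+* ℝ) (hw₂ : ∀ x : F, w₂ (algebraMap F K x) = v 1 x)
    (hw₂' : ∀ x : F, w₂' (algebraMap F K x) = v 1 x)
    (τ : K) (τ₁ : UpperHalfPlane) (hτ₁ : (τ₁ : ℂ) = w₁ τ) (hτ₂ : w₂ τ < w₂' τ)
    (γ : Matrix.SpecialLinearGroup (Fin 2) (NumberField.RingOfIntegers F))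
    (hγ : HilbertEis.IsGeneratorModTorsion τ γ)
    (hγpos : ∀ t : ℝ, ∃ t' : ℝ, t < t' ∧
      HilbertEis.embSL (v 1) γ • HilbertEis.upsilon (w₂ τ) (w₂' τ) hτ₂ t =
        HilbertEis.upsilon (w₂ τ) (w₂' τ) hτ₂ t')
    (a b : ℝ) (hab : HilbertEis.IsFundamentalArc v τ τ₁ (w₂ τ) (w₂' τ) hτ₂ a b)
    (P : UpperHalfPlane × UpperHalfPlane) (hP₁ : P.1 = τ₁)
    (hP₂ : P.2 ∈ Set.range (HilbertEis.upsilon (w₂ τ) (w₂' τ) hτ₂)) :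
    HilbertEis.PhiEis v δ (HilbertEis.DeltaTau v τ₁ (w₂ τ) (w₂' τ) hτ₂ a b) =
      HilbertEis.rhoP v δ P γ := by
  have htrans : ∀ A ∈ HilbertEis.GammaTau F τ, ∃ s : ℝ, ∀ t : ℝ,
      HilbertEis.embSL (v 1) A • HilbertEis.upsilon (w₂ τ) (w₂' τ) hτ₂ t =
        HilbertEis.upsilon (w₂ τ) (w₂' τ) hτ₂ (t + s) := fun A hA =>
    HilbertEis.exists_translation_of_fixes hτ₂
      (HilbertEis.embSL_fixes_of_mem_GammaTau hA w₂ hw₂)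
      (HilbertEis.embSL_fixes_of_mem_GammaTau hA w₂' hw₂')
  have hfix : ∀ A ∈ HilbertEis.GammaTau F τ, HilbertEis.embSL (v 0) A • τ₁ = τ₁ := fun A hA =>
    HilbertEis.embSL_smul_of_mem_GammaTau hA w₁ hw₁ hτ₁
  obtain ⟨hγmem, hγgen⟩ := hγ
  obtain ⟨l, hl⟩ := htrans γ hγmem
  have hlpos : 0 < l := by
    obtain ⟨t', ht', he⟩ := hγpos 0
    rw [hl] at he
    have := HilbertEis.upsilon_injective hτ₂ he
    linarith
  have hmult : ∀ A ∈ HilbertEis.GammaTau F τ, ∃ k : ℤ, ∀ t : ℝ,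
      HilbertEis.embSL (v 1) A • HilbertEis.upsilon (w₂ τ) (w₂' τ) hτ₂ t =
        HilbertEis.upsilon (w₂ τ) (w₂' τ) hτ₂ (t + k * l) := by
    intro A hA
    obtain ⟨k, hk⟩ := hγgen A hA
    obtain ⟨s, hs⟩ := htrans A hA
    refine ⟨k, fun t => ?_⟩
    -- The torsion element `γ ^ (-k) * A` translates by `s - k l`, which must therefore vanish.
    have h0 : s + (-k : ℤ) * l = 0 := by
      refine HilbertEis.translation_eq_zero_of_isOfFinOrder (h := hτ₂) (fun t => ?_)
        ((HilbertEis.embSL (v 1)).isOfFinOrder hk)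
      rw [map_mul, map_zpow, mul_smul, hs, HilbertEis.zpow_smul_upsilon hl, add_assoc]
    push_cast at h0
    rw [hs, show s = k * l by linarith]
  have hact : ∀ t, HilbertEis.act v γ (HilbertEis.Rtau τ₁ (w₂ τ) (w₂' τ) hτ₂ t) =
      HilbertEis.Rtau τ₁ (w₂ τ) (w₂' τ) hτ₂ (t + l) := fun t =>
    Prod.ext (hfix γ hγmem) (hl t)
  have hba : b - a = l := by
    refine HilbertEis.sub_eq_of_existsUnique_Ico hlpos hab.1 fun t => ?_
    -- The `Γ_τ`-orbits on the curve are the classes of times modulo `l`: powers of `γ` give one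
    -- inclusion, `hmult` the other.
    convert hab.2 t using 4 with s
    constructor
    · rintro ⟨k, rfl⟩
      refine ⟨γ ^ k, zpow_mem hγmem k, Prod.ext (hfix _ (zpow_mem hγmem k)) ?_⟩
      change HilbertEis.embSL (v 1) (γ ^ k) • _ = _
      rw [map_zpow]
      exact HilbertEis.zpow_smul_upsilon hl k t
    · rintro ⟨A, hA, he⟩
      obtain ⟨k, hk⟩ := hmult A hA
      refine ⟨k, (HilbertEis.upsilon_injective hτ₂ ?_).symm⟩
      rw [← hk]
      exact congrArg Prod.snd he
  obtain ⟨t₀, ht₀⟩ := hP₂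
  obtain rfl : P = HilbertEis.Rtau τ₁ (w₂ τ) (w₂' τ) hτ₂ t₀ := Prod.ext hP₁ ht₀.symm
  have h₁ : ContDiff ℝ (↑(⊤ : ℕ∞)) fun t =>
      ((HilbertEis.Rtau τ₁ (w₂ τ) (w₂' τ) hτ₂ t).1 : ℂ) :=
    contDiff_const (c := (τ₁ : ℂ))
  have h₂ : ContDiff ℝ (↑(⊤ : ℕ∞)) fun t =>
      ((HilbertEis.Rtau τ₁ (w₂ τ) (w₂' τ) hτ₂ t).2 : ℂ) :=
    HilbertEis.contDiff_upsilon (w₂ τ) (w₂' τ) hτ₂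
  have hΔ : HilbertEis.DeltaTau v τ₁ (w₂ τ) (w₂' τ) hτ₂ a b =
      Finsupp.single ((HilbertEis.affineSimplex _ h₁ h₂ ![a, a + l]).proj v) 1 := by
    refine congrArg (fun s => Finsupp.single s (1 : ℤ)) (Subtype.ext (funext fun x =>
      congrArg (fun t => HilbertEis.toX v (HilbertEis.Rtau τ₁ (w₂ τ) (w₂' τ) hτ₂ t)) ?_))
    rw [HilbertEis.sum_mul_vecCons_add, hba]
  have hS : HilbertEis.SP v (HilbertEis.Rtau τ₁ (w₂ τ) (w₂' τ) hτ₂ t₀) γ =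
      Finsupp.single ((HilbertEis.affineSimplex _ h₁ h₂ ![t₀, t₀ + l]).proj v) 1 := by
    rw [HilbertEis.SP, hact]
    refine congrArg (fun s => Finsupp.single s (1 : ℤ)) (Subtype.ext (funext fun x =>
      congrArg (HilbertEis.toX v) (Prod.ext (HilbertEis.geod_self τ₁ _)
        ((HilbertEis.geod_upsilon hτ₂ t₀ (x 1) hlpos).trans
          (congrArg (HilbertEis.upsilon (w₂ τ) (w₂' τ) hτ₂)
            (HilbertEis.sum_mul_vecCons_add x t₀ l).symm)))))
  rw [HilbertEis.rhoP, hΔ, hS]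
  refine HilbertEis.PhiEis_eq_of_boundary v δ _
    (HilbertEis.boundary_affineSimplex_sub v h₁ h₂ hact a t₀) ?_
  rw [map_sub, HilbertEis.integral, Finsupp.linearCombination_single,
    Finsupp.linearCombination_single,
    HilbertEis.integralSimplex_affineSimplex v δ (z₁ := τ₁) (fun _ => rfl),
    HilbertEis.integralSimplex_affineSimplex v δ (z₁ := τ₁) (fun _ => rfl), sub_self]
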